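/- Fix positive integers $S, A, n, H, T$. Consider an episodic Markov decision process with $S$ states, $A$ actions, horizon $H$, initial state distribution $\rho$, unknown transition function $P^\star$ (so $s_1\sim\rho$ and $s_{h+1}\sim P^\star(s_h,a_h,\cdot)$ for $1\le h<H$), and $n$ known reward functions $r_1,\dots,r_n$ with values $r_i(s,a)\in[0,1]$. For a transition function $P$ and a (possibly non-stationary, randomized) policy $\pi=(\pi_1,\dots,\pi_H)$ let $$V^\pi(r_i;P)=\mathbb E_{\pi,P}\Big[\sum_{h=1}^H r_i(s_h,a_h)\Big],\qquad \mathrm{MW}(\pi;P)=\min_{1\le i\le n}V^\pi(r_i;P).$$ A learner interacts with the process for $T$ episodes and uses the following algorithm with confidence parameter $\delta\in(0,1)$. Let $C_0$ be the set of all transition functions. In episode $t=1,2,\dots$ the learner computes $$\tilde P_t\in\operatorname*{argmax}_{P\in C_{t-1}}\ \max_\pi \mathrm{MW}(\pi;P),\qquad \tilde\pi_t\in\operatorname*{argmax}_\pi \mathrm{MW}(\pi;\tilde P_t)$$ (ties are broken arbitrarily, as a function of the observed history), plays $\tilde\pi_t$ for the $H$ steps, and observes $s_{t,1},a_{t,1},\dots,s_{t,H},a_{t,H}$.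 After episode $t$ it forms the counts $$N_t(s,a)=\sum_{t'\le t}\sum_{h=1}^{H-1}\mathbf 1\{s_{t',h}=s,\,a_{t',h}=a\},\qquad N_t(s,a,s')=\sum_{t'\le t}\sum_{h=1}^{H-1}\mathbf 1\{s_{t',h}=s,\,a_{t',h}=a,\,s_{t',h+1}=s'\},$$ the empirical transition function $\widehat P_t(s,a,s')=N_t(s,a,s')/N_t(s,a)$ (taken to be $1/S$ if $N_t(s,a)=0$), and the confidence set $C_t$ of all transition functions $P$ with $$\|P(s,a,\cdot)-\widehat P_t(s,a,\cdot)\|_1\le\sqrt{\frac{4S\log(SAt/\delta)}{\max\{1,N_t(s,a)\}}}\qquad\text{for all } s,a.$$ The regret for minimum welfare is $$\mathrm{Reg}_{\mathrm{MW}}(T)=\sum_{t=1}^T\Big(\max_\pi \mathrm{MW}(\pi;P^\star)-\mathrm{MW}(\tilde\pi_t;P^\star)\Big).$$ **Theorem.** There are absolute constants $C>0$ and $k\in\mathbb N$ such that, for all $S,A,n,H,T,\rho,P^\star,r_1,\dots,r_n$ and $\delta$ as above, with probability at least $1-\delta$, $$\mathrm{Reg}_{\mathrm{MW}}(T)\le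 C\,H^2S\sqrt{AT}\,\Big(1+\log\frac{SAT}{\delta}\Big)^k .$$ In particular the regret is $\tilde O(H^2S\sqrt{AT})$, with no dependence on the number $n$ of agents. -/

import Mathlib

noncomputable section

namespace FairRL

/-- Transition functions on `S` states and `A` actions; `(P s a).1 s'` is `P(s, a, s')`. -/
abbrev TransFn (S A : ℕ) : Type := Fin S → Fin A → stdSimplex ℝ (Fin S)

/-- Non-stationary policies with horizon `H`; `(π h s).1 a` is the probability of playing
action `a` in state `s` at time-step `h`. -/
abbrev Policy (S A H : ℕ) : Type := Fin H → Fin S → stdSimplex ℝ (Fin A)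

/-- State-action sequences of one episode. -/
abbrev Traj (S A H : ℕ) : Type := Fin H → Fin S × Fin A

/-- Reward functions of the `n` agents. -/
abbrev Rewards (S A n : ℕ) : Type := Fin n → Fin S → Fin A → ℝ

/-- The probability that an episode played with policy `π` in the MDP with transition function
`P` and initial distribution `ρ` produces the state-action sequence `τ`. -/
def trajProb {S A H : ℕ} (ρ : stdSimplex ℝ (Fin S)) (P : TransFn S A) (π : Policy S A H)
    (τ : Traj S A H) : ℝ :=
  ∏ h : Fin H,
    (if h.1 = 0 then ρ.1 (τ h).1
      else (P (τ ⟨h.1 - 1, by omega⟩).1 (τ ⟨h.1 - 1, by omega⟩).2).1 (τ h).1) *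
    (π h (τ h).1).1 (τ h).2

/-- The value function: the expected total reward over an episode. -/
def value {S A H : ℕ} (ρ : stdSimplex ℝ (Fin S)) (r : Fin S → Fin A → ℝ) (P : TransFn S A)
    (π : Policy S A H) : ℝ :=
  ∑ τ : Traj S A H, trajProb ρ P π τ * ∑ h : Fin H, r (τ h).1 (τ h).2

/-- Minimum welfare: the smallest value among the agents. -/
def minWelfare {S A n H : ℕ} (ρ : stdSimplex ℝ (Fin S)) (r : Rewards S A n) (P : TransFn S A)
    (π : Policy S A H) : ℝ :=
  ⨅ i : Fin n, value ρ (r i) P π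

/-- The largest minimum welfare that a policy of horizon `H` achieves under `P`. -/
def optWelfare {S A n : ℕ} (H : ℕ) (ρ : stdSimplex ℝ (Fin S)) (r : Rewards S A n)
    (P : TransFn S A) : ℝ :=
  ⨆ π : Policy S A H, minWelfare ρ r P π

/-- The number of transitions out of `s` under action `a` observed in the episodes `ω`. -/
def visitCount {S A H t : ℕ} (ω : Fin t → Traj S A H) (s : Fin S) (a : Fin A) : ℕ :=
  ∑ i : Fin t, ∑ h : Fin (H - 1), if ω i ⟨h.1, by omega⟩ = (s, a) then 1 else 0

/-- The number of transitions from `s` under action `a` to `s'` observed in the episodes `ω`. -/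
def transCount {S A H t : ℕ} (ω : Fin t → Traj S A H) (s : Fin S) (a : Fin A) (s' : Fin S) : ℕ :=
  ∑ i : Fin t, ∑ h : Fin (H - 1),
    if ω i ⟨h.1, by omega⟩ = (s, a) ∧ (ω i ⟨h.1 + 1, by omega⟩).1 = s' then 1 else 0

/-- The empirical transition function (uniform at pairs from which no transition was observed). -/
def empTrans {S A H t : ℕ} (ω : Fin t → Traj S A H) (s : Fin S) (a : Fin A) (s' : Fin S) : ℝ :=
  if visitCount ω s a = 0 then 1 / S else (transCount ω s a s' : ℝ) / visitCount ω s a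

/-- The confidence set computed from the `t` episodes `ω`. Before the first episode it contains
all transition functions. -/
def confSet {S A H t : ℕ} (δ : ℝ) (ω : Fin t → Traj S A H) : Set (TransFn S A) :=
  {P | 0 < t → ∀ s a, ∑ s' : Fin S, |(P s a).1 s' - empTrans ω s a s'| ≤
    √(4 * S * Real.log (S * A * t / δ) / max 1 (visitCount ω s a : ℝ))}

/-- A learner chooses, from the observed episodes, a model and the policy of the next episode. -/
abbrev Learner (S A H : ℕ) : Type :=
  (t : ℕ) → (Fin t → Traj S A H) → TransFn S A × Policy S A H

/-- The learner follows the optimistic algorithm for minimum welfare with confidence parameter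
`δ` (ties in either maximization are broken in an arbitrary way): the model maximizes the optimal
welfare over the confidence set, and the policy is optimal for that model. -/
def IsUCRL {S A n H : ℕ} (ρ : stdSimplex ℝ (Fin S)) (r : Rewards S A n) (δ : ℝ)
    (L : Learner S A H) : Prop :=
  ∀ (t : ℕ) (ω : Fin t → Traj S A H),
    (L t ω).1 ∈ confSet δ ω ∧
    (∀ P ∈ confSet δ ω, optWelfare H ρ r P ≤ optWelfare H ρ r (L t ω).1) ∧
    ∀ π : Policy S A H, minWelfare ρ r (L t ω).1 π ≤ minWelfare ρ r (L t ω).1 (L t ω).2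

/-- The policy played by the learner in episode `t` of the run `ω` (counting from `0`), chosen
from the episodes before it. -/
def playedPolicy {S A H T : ℕ} (L : Learner S A H) (ω : Fin T → Traj S A H) (t : Fin T) :
    Policy S A H :=
  (L t.1 fun i => ω (Fin.castLE t.2.le i)).2

/-- The probability that the first `T` episodes of the learner, in the MDP with transition
function `P` and initial distribution `ρ`, are `ω`. -/
def runProb {S A H T : ℕ} (ρ : stdSimplex ℝ (Fin S)) (P : TransFn S A) (L : Learner S A H)
    (ω : Fin T → Traj S A H) : ℝ :=
  ∏ t : Fin T, trajProb ρ P (playedPolicy L ω t) (ω t)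

/-- The probability of an event of the first `T` episodes. -/
def eventProb {S A H T : ℕ} (ρ : stdSimplex ℝ (Fin S)) (P : TransFn S A) (L : Learner S A H)
    (E : Set (Fin T → Traj S A H)) : ℝ :=
  ∑ ω : Fin T → Traj S A H, E.indicator (runProb ρ P L) ω

/-- The regret of the learner in the run `ω` with respect to minimum welfare. -/
def regret {S A n H T : ℕ} (ρ : stdSimplex ℝ (Fin S)) (r : Rewards S A n) (P : TransFn S A)
    (L : Learner S A H) (ω : Fin T → Traj S A H) : ℝ :=
  ∑ t : Fin T, (optWelfare H ρ r P - minWelfare ρ r P (playedPolicy L ω t))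

end FairRL

end

/-! The proof is optimism plus a pigeonhole count. Whenever the true model `P` lies in the
confidence set, the learner's model has optimal welfare at least that of `P`. The regret of the
episode is then at most the welfare gap of the played policy between the two models. Both models
induce laws on episodes, and every agent's value changes by at most `H` times the L1 distance of
these laws. The minimum over agents obeys the same bound (`minWelfare_sub_le`), so no union over
agents is needed and `n` disappears.

By a hybrid argument (`sum_abs_chain_sub_le`) that distance is at most the expected sum, along an
episode of the true model, of the L1 distances between transition rows. The confidence radii bound
this by the expected `bonus`. Azuma-Hoeffding (`eventProb_azuma_le`) replaces expected by realised
bonuses. The latter are sums of `1 / √N` over visits, which telescope for each state-action pair and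
add up by Cauchy-Schwarz (`sum_bonus_le`).

The confidence sets rest on an exponential supermartingale for sums of signed deviations, with a
union bound over pairs, sign vectors and count values (`eventProb_notMem_confSet_le`). The union
over counts costs a factor `H` that the radius does not contain. Hence only the sets built from more
than `H` episodes are used, and the first `H + 1` episodes are charged `H` each.

All probabilities are finite sums of products of adapted weights (`chain`), used both for the steps
of an episode and for the episodes of a run. -/

noncomputable section

namespace FairRL

/-! ### Products of adapted kernels -/

/-- The weight of a sequence `ω` when its `t`-th entry has weight `W t` given the entries before
it. -/
def chain {X : Type*} {T : ℕ} (W : (t : Fin T) → (Fin t → X) → X → ℝ) (ω : Fin T → X) : ℝ :=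
  ∏ t : Fin T, W t (fun i => ω (Fin.castLE t.2.le i)) (ω t)

section Chain

variable {X : Type*} {T : ℕ}

theorem chain_nonneg {W : (t : Fin T) → (Fin t → X) → X → ℝ} (h : ∀ t ω x, 0 ≤ W t ω x)
    (ω : Fin T → X) : 0 ≤ chain W ω :=
  Finset.prod_nonneg fun _ _ => h _ _ _

theorem chain_mul (W W' : (t : Fin T) → (Fin t → X) → X → ℝ) (ω : Fin T → X) :
    chain (fun t ω x => W t ω x * W' t ω x) ω = chain W ω * chain W' ω :=
  Finset.prod_mul_distrib

theorem snoc_castLE {t : ℕ} (ht : t ≤ T) (ω : Fin T → X) (x : X) (i : Fin t) :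
    (Fin.snoc ω x : Fin (T + 1) → X) (Fin.castLE (Nat.le_succ_of_le ht) i) =
      ω (Fin.castLE ht i) :=
  Fin.snoc_castSucc (α := fun _ => X) x ω (Fin.castLE ht i)

theorem chain_snoc (W : (t : Fin (T + 1)) → (Fin t → X) → X → ℝ) (ω : Fin T → X) (x : X) :
    chain W (Fin.snoc ω x) = chain (fun t : Fin T => W t.castSucc) ω * W (Fin.last T) ω x := by
  unfold chain
  rw [Fin.prod_univ_castSucc]
  congr 1
  · refine Finset.prod_congr rfl fun t _ => ?_
    congr 1
    · funext i
      exact snoc_castLE t.2.le ω x i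
    · simp
  · congr 1
    · funext i
      exact snoc_castLE le_rfl ω x i
    · simp

variable [Fintype X]

theorem sum_fin_succ_fun (F : (Fin (T + 1) → X) → ℝ) :
    ∑ ω, F ω = ∑ ω : Fin T → X, ∑ x, F (Fin.snoc ω x) := by
  rw [Finset.sum_comm, ← Fintype.sum_prod_type']
  exact (Fintype.sum_equiv (Fin.snocEquiv fun _ => X) _ _ fun _ => rfl).symm

/-- The last entry is summed out first. The weights need not be probabilities: kernels tilted by an
exponential are allowed, so this plays the role of the supermartingale property. -/
theorem sum_chain_le_one : ∀ {T : ℕ} {W : (t : Fin T) → (Fin t → X) → X → ℝ},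
    (∀ t ω x, 0 ≤ W t ω x) → (∀ t ω, ∑ x, W t ω x ≤ 1) → ∑ ω, chain W ω ≤ 1
  | 0, W, _, _ => by simp [chain]
  | T + 1, W, h0, h1 => by
    rw [sum_fin_succ_fun]
    simp only [chain_snoc, ← Finset.mul_sum]
    refine le_trans (Finset.sum_le_sum fun ω _ => ?_)
      (sum_chain_le_one (W := fun t : Fin T => W t.castSucc) (fun t => h0 t.castSucc) fun t => h1 t.castSucc)
    exact mul_le_of_le_one_right (chain_nonneg (fun t => h0 t.castSucc) ω) (h1 _ _)

theorem sum_chain_eq_one : ∀ {T : ℕ} {W : (t : Fin T) → (Fin t → X) → X → ℝ},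
    (∀ t ω, ∑ x, W t ω x = 1) → ∑ ω, chain W ω = 1
  | 0, W, _ => by simp [chain]
  | T + 1, W, h1 => by
    rw [sum_fin_succ_fun]
    simp only [chain_snoc, ← Finset.mul_sum, h1, mul_one]
    exact sum_chain_eq_one (W := fun t : Fin T => W t.castSucc) fun t => h1 t.castSucc

/-- The distance between two products of adapted kernels is at most the expected sum of the
distances between the kernels. -/
theorem sum_abs_chain_sub_le : ∀ {T : ℕ} {W W' : (t : Fin T) → (Fin t → X) → X → ℝ},
    (∀ t ω x, 0 ≤ W t ω x) → (∀ t ω x, 0 ≤ W' t ω x) → (∀ t ω, ∑ x, W t ω x = 1) →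
    (∀ t ω, ∑ x, W' t ω x = 1) →
    ∑ ω, |chain W ω - chain W' ω| ≤ ∑ ω, chain W ω * ∑ t : Fin T,
      ∑ x, |W t (fun i => ω (Fin.castLE t.2.le i)) x - W' t (fun i => ω (Fin.castLE t.2.le i)) x|
  | 0, W, W', _, _, _, _ => by simp [chain]
  | T + 1, W, W', h0, h0', h1, h1' => by
    rw [sum_fin_succ_fun, sum_fin_succ_fun]
    have ih := sum_abs_chain_sub_le (W := fun t : Fin T => W t.castSucc)
      (W' := fun t : Fin T => W' t.castSucc) (fun t => h0 t.castSucc) (fun t => h0' t.castSucc) (fun t => h1 t.castSucc)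
      fun t => h1' t.castSucc
    have hr (ω : Fin T → X) (x : X) : ∑ t : Fin (T + 1),
        ∑ y, |W t (fun i => (Fin.snoc ω x : Fin (T + 1) → X) (Fin.castLE t.2.le i)) y -
          W' t (fun i => (Fin.snoc ω x : Fin (T + 1) → X) (Fin.castLE t.2.le i)) y| =
        (∑ t : Fin T, ∑ y, |W t.castSucc (fun i => ω (Fin.castLE t.2.le i)) y -
          W' t.castSucc (fun i => ω (Fin.castLE t.2.le i)) y|) +
        ∑ y, |W (Fin.last T) ω y - W' (Fin.last T) ω y| := by
      rw [Fin.sum_univ_castSucc]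
      have e1 (t : Fin T) : (fun i => (Fin.snoc ω x : Fin (T + 1) → X)
          (Fin.castLE t.castSucc.2.le i)) = fun i => ω (Fin.castLE t.2.le i) :=
        funext fun i => snoc_castLE t.2.le ω x i
      have e2 : (fun i => (Fin.snoc ω x : Fin (T + 1) → X)
          (Fin.castLE (Fin.last T).2.le i)) = ω :=
        funext fun i => snoc_castLE le_rfl ω x i
      rw [e2]
      congr 1
      exact Finset.sum_congr rfl fun t _ => by rw [e1]; rfl
    simp only [hr, chain_snoc]
    -- With `c`, `c'` the prefix products and `w`, `w'` the last weights, `c w - c' w' = c (w - w')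
    -- + (c - c') w'`. This choice keeps every expectation under `W`, later the true model.
    calc _ ≤ ∑ ω : Fin T → X, ∑ x,
          (chain (fun t : Fin T => W t.castSucc) ω *
              |W (Fin.last T) ω x - W' (Fin.last T) ω x| +
            |chain (fun t : Fin T => W t.castSucc) ω - chain (fun t : Fin T => W' t.castSucc) ω| *
              W' (Fin.last T) ω x) := by
          refine Finset.sum_le_sum fun ω _ => Finset.sum_le_sum fun x _ => ?_
          have hc := chain_nonneg (W := fun t : Fin T => W t.castSucc) (fun t => h0 t.castSucc) ω
          conv_rhs => rw [← abs_of_nonneg hc, ← abs_mul, ← abs_of_nonneg (h0' (Fin.last T) ω x),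
            ← abs_mul, abs_of_nonneg hc, abs_of_nonneg (h0' (Fin.last T) ω x)]
          refine le_of_eq_of_le ?_ (abs_add_le _ _)
          congr 1
          ring
      _ = ∑ ω : Fin T → X, (chain (fun t : Fin T => W t.castSucc) ω *
              ∑ x, |W (Fin.last T) ω x - W' (Fin.last T) ω x| +
            |chain (fun t : Fin T => W t.castSucc) ω -
              chain (fun t : Fin T => W' t.castSucc) ω|) := by
          refine Finset.sum_congr rfl fun ω _ => ?_
          rw [Finset.sum_add_distrib, ← Finset.mul_sum, ← Finset.mul_sum, h1', mul_one]
      _ ≤ _ := by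
          rw [Finset.sum_add_distrib, add_comm]
          refine (add_le_add_left ih _).trans_eq ?_
          rw [← Finset.sum_add_distrib]
          refine Finset.sum_congr rfl fun ω _ => ?_
          rw [← Finset.sum_mul, ← Finset.mul_sum, h1, mul_one, mul_add]
          rfl

end Chain

/-! ### Concentration -/

/-- Hoeffding's lemma for a distribution on a finite type. -/
theorem sum_mul_exp_le {X : Type*} [Fintype X] {p : X → ℝ} (h0 : ∀ x, 0 ≤ p x)
    (h1 : ∑ x, p x = 1) {f : X → ℝ} {a b : ℝ} (hf : ∀ x, f x ∈ Set.Icc a b) (l : ℝ) :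
    ∑ x, p x * Real.exp (l * (f x - ∑ y, p y * f y)) ≤ Real.exp (l ^ 2 * (b - a) ^ 2 / 8) := by
  let _ : MeasurableSpace X := ⊤
  have hs : ∑ x, ENNReal.ofReal (p x) = 1 := by
    rw [← ENNReal.ofReal_sum_of_nonneg fun x _ => h0 x, h1, ENNReal.ofReal_one]
  have hint (g : X → ℝ) : ∫ x, g x ∂(PMF.ofFintype _ hs).toMeasure = ∑ x, p x * g x := by
    rw [PMF.integral_eq_sum]
    refine Finset.sum_congr rfl fun x _ => ?_
    simp [ENNReal.toReal_ofReal (h0 x)]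
  have h := (ProbabilityTheory.hasSubgaussianMGF_of_mem_Icc (X := f) (a := a) (b := b)
    (μ := (PMF.ofFintype _ hs).toMeasure) (measurable_from_top).aemeasurable
    (Filter.Eventually.of_forall hf)).mgf_le l
  rw [ProbabilityTheory.mgf, hint, hint] at h
  refine h.trans (Real.exp_le_exp.2 (le_of_eq ?_))
  push_cast
  rw [Real.norm_eq_abs, div_pow, sq_abs]
  ring

/-- Markov's inequality for a distribution on a finite type. -/
theorem sum_indicator_le_inv {X : Type*} [Fintype X] {p z : X → ℝ} (h0 : ∀ x, 0 ≤ p x)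
    (hz : ∀ x, 0 ≤ z x) (h1 : ∑ x, p x * z x ≤ 1) {M : ℝ} (hM : 0 < M) {E : Set X}
    (hE : ∀ x ∈ E, M ≤ z x) : ∑ x, E.indicator p x ≤ M⁻¹ := by
  rw [← one_div, le_div_iff₀ hM, Finset.sum_mul]
  refine le_trans (Finset.sum_le_sum fun x _ => ?_) h1
  by_cases hx : x ∈ E
  · rw [Set.indicator_of_mem hx]
    exact mul_le_mul_of_nonneg_left (hE x hx) (h0 x)
  · rw [Set.indicator_of_notMem hx, zero_mul]
    exact mul_nonneg (h0 x) (hz x)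

/-! ### The laws of episodes and runs -/

section Laws

variable {S A H T : ℕ} (ρ : stdSimplex ℝ (Fin S)) (P : TransFn S A) (π : Policy S A H)
  (L : Learner S A H)

/-- The probability of the state-action pair `x` at time-step `h`, given the earlier ones. -/
def stepWeight (h : Fin H) (past : Fin h → Fin S × Fin A) (x : Fin S × Fin A) : ℝ :=
  (if hh : h.1 = 0 then ρ.1 x.1
    else (P (past ⟨h.1 - 1, by omega⟩).1 (past ⟨h.1 - 1, by omega⟩).2).1 x.1) * (π h x.1).1 x.2

theorem stepWeight_nonneg (h : Fin H) (past : Fin h → Fin S × Fin A) (x : Fin S × Fin A) :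
    0 ≤ stepWeight ρ P π h past x := by
  unfold stepWeight
  split_ifs
  · exact mul_nonneg (ρ.2.1 _) ((π h x.1).2.1 _)
  · exact mul_nonneg ((P _ _).2.1 _) ((π h x.1).2.1 _)

theorem sum_mul_policy (h : Fin H) (f : Fin S → ℝ) :
    ∑ x : Fin S × Fin A, f x.1 * (π h x.1).1 x.2 = ∑ s, f s := by
  rw [Fintype.sum_prod_type]
  refine Finset.sum_congr rfl fun s _ => ?_
  change ∑ a, f s * (π h s).1 a = f s
  rw [← Finset.mul_sum, (π h s).2.2, mul_one]

theorem sum_stepWeight (h : Fin H) (past : Fin h → Fin S × Fin A) :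
    ∑ x, stepWeight ρ P π h past x = 1 := by
  unfold stepWeight
  split_ifs
  · exact (sum_mul_policy π h _).trans ρ.2.2
  · exact (sum_mul_policy π h _).trans (P _ _).2.2

theorem trajProb_eq_chain (τ : Traj S A H) : trajProb ρ P π τ = chain (stepWeight ρ P π) τ := by
  unfold trajProb chain stepWeight
  refine Finset.prod_congr rfl fun h _ => ?_
  split_ifs <;> rfl

theorem trajProb_nonneg (τ : Traj S A H) : 0 ≤ trajProb ρ P π τ := by
  rw [trajProb_eq_chain]
  exact chain_nonneg (stepWeight_nonneg ρ P π) τ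

theorem sum_trajProb : ∑ τ, trajProb ρ P π τ = 1 := by
  simp only [trajProb_eq_chain]
  exact sum_chain_eq_one (sum_stepWeight ρ P π)

theorem runProb_eq_chain (ω : Fin T → Traj S A H) :
    runProb ρ P L ω = chain (fun t ω τ => trajProb ρ P (L t.1 ω).2 τ) ω := rfl

theorem runProb_nonneg (ω : Fin T → Traj S A H) : 0 ≤ runProb ρ P L ω :=
  chain_nonneg (fun _ _ => trajProb_nonneg ρ P _) ω

theorem sum_runProb : ∑ ω : Fin T → Traj S A H, runProb ρ P L ω = 1 :=
  sum_chain_eq_one (W := fun t ω τ => trajProb ρ P (L t.1 ω).2 τ) fun _ _ => sum_trajProb ρ P _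

theorem sum_runProb_mul_exp_le_one
    (f : (t : Fin T) → (Fin t → Traj S A H) → Traj S A H → ℝ)
    (hf : ∀ t ω, ∑ τ, trajProb ρ P (L t.1 ω).2 τ * Real.exp (f t ω τ) ≤ 1) :
    ∑ ω : Fin T → Traj S A H, runProb ρ P L ω *
      Real.exp (∑ t : Fin T, f t (fun i => ω (Fin.castLE t.2.le i)) (ω t)) ≤ 1 := by
  refine le_of_eq_of_le (Finset.sum_congr rfl fun ω _ => ?_) (sum_chain_le_one
    (W := fun t ω τ => trajProb ρ P (L t.1 ω).2 τ * Real.exp (f t ω τ))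
    (fun t ω τ => mul_nonneg (trajProb_nonneg ρ P _ τ) (Real.exp_nonneg _)) hf)
  rw [chain_mul, runProb_eq_chain, Real.exp_sum]
  rfl

/-- The distance between the laws of an episode under two models is at most the expected sum of
the distances between the transition probabilities at the visited state-action pairs. -/
theorem sum_abs_trajProb_sub_le (P' : TransFn S A) :
    ∑ τ, |trajProb ρ P π τ - trajProb ρ P' π τ| ≤
      ∑ τ, trajProb ρ P π τ * ∑ h : Fin (H - 1),
        ∑ s', |(P (τ ⟨h.1, by omega⟩).1 (τ ⟨h.1, by omega⟩).2).1 s' -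
          (P' (τ ⟨h.1, by omega⟩).1 (τ ⟨h.1, by omega⟩).2).1 s'| := by
  simp only [trajProb_eq_chain]
  refine (sum_abs_chain_sub_le (stepWeight_nonneg ρ P π) (stepWeight_nonneg ρ P' π)
    (sum_stepWeight ρ P π) (sum_stepWeight ρ P' π)).trans_eq ?_
  refine Finset.sum_congr rfl fun τ _ => ?_
  congr 1
  cases H with
  | zero => rfl
  | succ H =>
    -- The first pair has the same law under both models, so only the `H - 1` transitions
    -- contribute.
    rw [Fin.sum_univ_succ, Finset.sum_eq_zero, zero_add]
    · refine Finset.sum_congr rfl fun h _ => ?_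
      have hs : ¬(h.succ : ℕ) = 0 := Nat.succ_ne_zero _
      rw [← sum_mul_policy π h.succ]
      refine Finset.sum_congr rfl fun x _ => ?_
      rw [stepWeight, stepWeight, dif_neg hs, dif_neg hs,
        ← sub_mul, abs_mul, abs_of_nonneg ((π h.succ x.1).2.1 x.2)]
      rfl
    · intro x _
      rw [stepWeight, stepWeight, dif_pos (by rfl), dif_pos (by rfl), sub_self, abs_zero]

/-- The deviations of the transitions out of `(s, a)` in one episode are sub-Gaussian. -/
theorem sum_trajProb_mul_exp_le_one {f : Fin S → ℝ} (hf : ∀ s', f s' ∈ Set.Icc (-1 : ℝ) 1)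
    (l : ℝ) (s : Fin S) (a : Fin A) :
    ∑ τ : Traj S A H, trajProb ρ P π τ * Real.exp (∑ h : Fin (H - 1),
      if τ ⟨h.1, by omega⟩ = (s, a) then
        l * (f (τ ⟨h.1 + 1, by omega⟩).1 - ∑ s', (P s a).1 s' * f s') - l ^ 2 / 2
      else 0) ≤ 1 := by
  -- The tilt for the transition out of step `h - 1` is attached to step `h`, where the next state
  -- is revealed; the initial step gets tilt `1`.
  set g : (h : Fin H) → (Fin h → Fin S × Fin A) → Fin S × Fin A → ℝ := fun h past x =>
    if hh : h.1 = 0 then 1 else Real.exp (if past ⟨h.1 - 1, by omega⟩ = (s, a) then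
      l * (f x.1 - ∑ s', (P s a).1 s' * f s') - l ^ 2 / 2 else 0) with hg
  have hg0 (h past x) : 0 ≤ g h past x := by
    rw [hg]
    dsimp only
    split_ifs <;> positivity
  refine le_of_eq_of_le (Finset.sum_congr rfl fun τ _ => ?_) (sum_chain_le_one
    (W := fun h past x => stepWeight ρ P π h past x * g h past x)
    (fun h past x => mul_nonneg (stepWeight_nonneg ρ P π h past x) (hg0 h past x)) ?_)
  · rw [chain_mul, trajProb_eq_chain]
    congr 1
    rw [Real.exp_sum]
    cases H with
    | zero => rfl
    | succ H =>
      rw [chain, Fin.prod_univ_succ]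
      exact (one_mul _).symm
  · intro h past
    by_cases hh : h.1 = 0
    · simp only [hg, hh, dite_true, mul_one, sum_stepWeight]
      exact le_rfl
    · by_cases hp : past ⟨h.1 - 1, by omega⟩ = (s, a)
      · simp only [hg, stepWeight, hh, dite_false, hp, if_true]
        rw [Finset.sum_congr rfl fun x _ => mul_right_comm _ _ _,
          sum_mul_policy π h fun s' => (P s a).1 s' *
          Real.exp (l * (f s' - ∑ s', (P s a).1 s' * f s') - l ^ 2 / 2)]
        simp only [Real.exp_sub _ (l ^ 2 / 2), ← mul_div_assoc, ← Finset.sum_div]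
        rw [div_le_one (Real.exp_pos _)]
        -- The range `[-1, 1]` has length `2`, so Hoeffding's exponent is `l ^ 2 * 2 ^ 2 / 8 = l ^ 2
        -- / 2`.
        refine (sum_mul_exp_le (P s a).2.1 (P s a).2.2 hf l).trans_eq ?_
        congr 1
        ring
      · simp only [hg, hh, dite_false, hp, if_false, Real.exp_zero, mul_one, sum_stepWeight]
        exact le_rfl

end Laws

/-! ### Values -/

section Values

variable {S A n H : ℕ} {ρ : stdSimplex ℝ (Fin S)} {P : TransFn S A} {π : Policy S A H}

theorem sum_reward_mem_Icc {r : Fin S → Fin A → ℝ} (hr : ∀ s a, 0 ≤ r s a ∧ r s a ≤ 1)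
    (τ : Traj S A H) : ∑ h : Fin H, r (τ h).1 (τ h).2 ∈ Set.Icc (0 : ℝ) H := by
  refine ⟨Finset.sum_nonneg fun h _ => (hr _ _).1, ?_⟩
  refine (Finset.sum_le_sum fun h _ => (hr (τ h).1 (τ h).2).2).trans_eq ?_
  simp

theorem value_mem_Icc {r : Fin S → Fin A → ℝ} (hr : ∀ s a, 0 ≤ r s a ∧ r s a ≤ 1) :
    value ρ r P π ∈ Set.Icc (0 : ℝ) H := by
  refine ⟨Finset.sum_nonneg fun τ _ => mul_nonneg (trajProb_nonneg ρ P π τ)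
    (sum_reward_mem_Icc hr τ).1, ?_⟩
  refine (Finset.sum_le_sum fun τ _ => mul_le_mul_of_nonneg_left (sum_reward_mem_Icc hr τ).2
    (trajProb_nonneg ρ P π τ)).trans_eq ?_
  rw [← Finset.sum_mul, sum_trajProb, one_mul]

theorem value_sub_le {r : Fin S → Fin A → ℝ} (hr : ∀ s a, 0 ≤ r s a ∧ r s a ≤ 1)
    (P' : TransFn S A) :
    value ρ r P' π - value ρ r P π ≤ H * ∑ τ, |trajProb ρ P π τ - trajProb ρ P' π τ| := by
  rw [value, value, ← Finset.sum_sub_distrib, Finset.mul_sum]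
  refine Finset.sum_le_sum fun τ _ => ?_
  rw [← sub_mul, mul_comm (H : ℝ), abs_sub_comm]
  have h := sum_reward_mem_Icc hr τ
  exact (mul_le_mul_of_nonneg_right (le_abs_self _) h.1).trans
    (mul_le_mul_of_nonneg_left h.2 (abs_nonneg _))

variable {r : Rewards S A n}

theorem minWelfare_mem_Icc (hn : 0 < n) (hr : ∀ i s a, 0 ≤ r i s a ∧ r i s a ≤ 1) :
    minWelfare ρ r P π ∈ Set.Icc (0 : ℝ) H := by
  have : Nonempty (Fin n) := ⟨⟨0, hn⟩⟩
  exact ⟨le_ciInf fun i => (value_mem_Icc (hr i)).1,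
    (ciInf_le (Set.finite_range _).bddBelow ⟨0, hn⟩).trans (value_mem_Icc (hr _)).2⟩

/-- The bound on the change of value is the same for every agent, so it passes to the infimum with
no loss in `n`. -/
theorem minWelfare_sub_le (hn : 0 < n) (hr : ∀ i s a, 0 ≤ r i s a ∧ r i s a ≤ 1)
    (P' : TransFn S A) :
    minWelfare ρ r P' π - minWelfare ρ r P π ≤
      H * ∑ τ, |trajProb ρ P π τ - trajProb ρ P' π τ| := by
  have : Nonempty (Fin n) := ⟨⟨0, hn⟩⟩
  rw [sub_le_comm]
  refine le_ciInf fun i => ?_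
  have h1 : minWelfare ρ r P' π ≤ value ρ (r i) P' π := ciInf_le (Set.finite_range _).bddBelow i
  have h2 := value_sub_le (ρ := ρ) (P := P) (π := π) (hr i) P'
  linarith

theorem optWelfare_le (hn : 0 < n) (hr : ∀ i s a, 0 ≤ r i s a ∧ r i s a ≤ 1)
    (π : Policy S A H) : optWelfare H ρ r P ≤ H := by
  have : Nonempty (Policy S A H) := ⟨π⟩
  exact ciSup_le fun π => (minWelfare_mem_Icc hn hr).2

end Values

/-! ### Events of a run: union bound, prefixes and Azuma-Hoeffding -/

section Events

variable {S A H : ℕ} {ρ : stdSimplex ℝ (Fin S)} {P : TransFn S A} {L : Learner S A H}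

theorem eventProb_le_sum {T : ℕ} {ι : Type*} (I : Finset ι) (F : ι → Set (Fin T → Traj S A H))
    {E : Set (Fin T → Traj S A H)} (hE : ∀ ω ∈ E, ∃ i ∈ I, ω ∈ F i) :
    eventProb ρ P L E ≤ ∑ i ∈ I, eventProb ρ P L (F i) := by
  unfold eventProb
  rw [Finset.sum_comm]
  refine Finset.sum_le_sum fun ω _ => ?_
  have h0 (i : ι) : 0 ≤ (F i).indicator (runProb ρ P L) ω :=
    Set.indicator_nonneg (fun ω _ => runProb_nonneg ρ P L ω) ω
  by_cases hω : ω ∈ E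
  · obtain ⟨i, hi, hiF⟩ := hE ω hω
    rw [Set.indicator_of_mem hω, ← Set.indicator_of_mem hiF (runProb ρ P L)]
    exact Finset.single_le_sum (f := fun i => (F i).indicator (runProb ρ P L) ω)
      (fun i _ => h0 i) hi
  · rw [Set.indicator_of_notMem hω]
    exact Finset.sum_nonneg fun i _ => h0 i

theorem eventProb_compl {T : ℕ} (E : Set (Fin T → Traj S A H)) :
    eventProb ρ P L E = 1 - eventProb ρ P L Eᶜ := by
  rw [eq_sub_iff_add_eq, eventProb, eventProb, ← Finset.sum_add_distrib, ← sum_runProb ρ P L]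
  exact Finset.sum_congr rfl fun ω _ => Set.indicator_self_add_compl_apply E _ ω

/-- The law of the first `t` episodes of a run is the law of a run of `t` episodes. -/
theorem eventProb_prefix {t T : ℕ} (htT : t ≤ T) (E : Set (Fin t → Traj S A H)) :
    eventProb ρ P L {ω : Fin T → Traj S A H | (fun i => ω (Fin.castLE htT i)) ∈ E} =
      eventProb ρ P L E := by
  induction T, htT using Nat.le_induction with
  | base => rfl
  | succ T hT ih =>
    rw [← ih, eventProb, sum_fin_succ_fun, eventProb]
    refine Finset.sum_congr rfl fun ω _ => ?_
    have hs (τ : Traj S A H) : (fun i => (Fin.snoc ω τ : Fin (T + 1) → Traj S A H)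
        (Fin.castLE (Nat.le_succ_of_le hT) i)) = fun i => ω (Fin.castLE hT i) :=
      funext fun i => snoc_castLE hT ω τ i
    by_cases hω : (fun i => ω (Fin.castLE hT i)) ∈ E
    · rw [Set.indicator_of_mem (by exact hω)]
      refine (Finset.sum_congr rfl fun τ _ =>
        Set.indicator_of_mem (by rw [Set.mem_ofPred_eq, hs]; exact hω) _).trans ?_
      simp only [runProb_eq_chain, chain_snoc, ← Finset.mul_sum, sum_trajProb, mul_one]
      rfl
    · rw [Set.indicator_of_notMem (by exact hω)]
      exact Finset.sum_eq_zero fun τ _ =>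
        Set.indicator_of_notMem (by rw [Set.mem_ofPred_eq, hs]; exact hω) _

/-- The Azuma-Hoeffding inequality for functions of the episodes of a run. -/
theorem eventProb_azuma_le {T : ℕ} (hT : 0 < T)
    (Y : (t : Fin T) → (Fin t → Traj S A H) → Traj S A H → ℝ) {b : ℝ} (hb : 0 < b)
    (hY : ∀ t ω τ, Y t ω τ ∈ Set.Icc 0 b) {η : ℝ} (hη : 0 < η) (hη1 : η ≤ 1) :
    eventProb ρ P L {ω : Fin T → Traj S A H | b * √(T * Real.log (1 / η) / 2) <
      ∑ t : Fin T, ((∑ τ, trajProb ρ P (playedPolicy L ω t) τ *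
        Y t (fun i => ω (Fin.castLE t.2.le i)) τ) -
          Y t (fun i => ω (Fin.castLE t.2.le i)) (ω t))} ≤ η := by
  have hT' : (0 : ℝ) < T := Nat.cast_pos.2 hT
  have hlog : 0 ≤ Real.log (1 / η) := Real.log_nonneg (by rwa [le_div_iff₀ hη, one_mul])
  set v : ℝ := √(T * Real.log (1 / η) / 2) with hv
  have hv2 : v ^ 2 = T * Real.log (1 / η) / 2 := Real.sq_sqrt (by positivity)
  -- This `l` maximises the Chernoff exponent `l * b * v - T * l ^ 2 * b ^ 2 / 8`; the maximum `2 *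
  -- v ^ 2 / T` equals `log (1 / η)`.
  set l : ℝ := 4 * v / (T * b) with hl
  have hl0 : 0 ≤ l := by positivity
  let f : (t : Fin T) → (Fin t → Traj S A H) → Traj S A H → ℝ := fun t ω τ =>
    l * ((∑ τ', trajProb ρ P (L t.1 ω).2 τ' * Y t ω τ') - Y t ω τ) - l ^ 2 * b ^ 2 / 8
  have hf (t : Fin T) (ω : Fin t → Traj S A H) :
      ∑ τ, trajProb ρ P (L t.1 ω).2 τ * Real.exp (f t ω τ) ≤ 1 := by
    have h := sum_mul_exp_le (trajProb_nonneg ρ P (L t.1 ω).2) (sum_trajProb ρ P (L t.1 ω).2)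
      (f := Y t ω) (hY t ω) (-l)
    simp only [f, Real.exp_sub _ (l ^ 2 * b ^ 2 / 8), ← mul_div_assoc, ← Finset.sum_div]
    rw [div_le_one (Real.exp_pos _)]
    rw [neg_sq, sub_zero] at h
    refine le_of_eq_of_le (Finset.sum_congr rfl fun τ _ => ?_) h
    congr 2
    ring
  refine (sum_indicator_le_inv (M := 1 / η) (runProb_nonneg ρ P L) (fun ω => Real.exp_nonneg _)
    (sum_runProb_mul_exp_le_one ρ P L f hf) (by positivity) fun ω hω => ?_).trans_eq
    (by rw [one_div, inv_inv])
  rw [← Real.log_le_iff_le_exp (by positivity), Finset.sum_sub_distrib, ← Finset.mul_sum]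
  have h1 := mul_le_mul_of_nonneg_left (le_of_lt (Set.mem_ofPred_eq ▸ hω)) hl0
  refine le_trans ?_ (sub_le_sub_right h1 _)
  have h2 : Real.log (1 / η) = v ^ 2 * 2 / T := by
    rw [hv2]
    field_simp
  rw [h2, Finset.sum_const, Finset.card_univ, Fintype.card_fin, nsmul_eq_mul, hl]
  refine le_of_eq ?_
  field_simp
  ring

end Events

/-! ### The confidence sets -/

section Confidence

variable {S A H t : ℕ}

theorem sum_transCount_mul (ω : Fin t → Traj S A H) (s : Fin S) (a : Fin A) (f : Fin S → ℝ) :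
    ∑ s', f s' * (transCount ω s a s' : ℝ) = ∑ i : Fin t, ∑ h : Fin (H - 1),
      if ω i ⟨h.1, by omega⟩ = (s, a) then f (ω i ⟨h.1 + 1, by omega⟩).1 else 0 := by
  simp only [transCount, Nat.cast_sum, Finset.mul_sum]
  rw [Finset.sum_comm]
  refine Finset.sum_congr rfl fun i _ => ?_
  rw [Finset.sum_comm]
  refine Finset.sum_congr rfl fun h _ => ?_
  by_cases hh : ω i ⟨h.1, by omega⟩ = (s, a) <;> simp [hh]

theorem visitCount_eq_sum (ω : Fin t → Traj S A H) (s : Fin S) (a : Fin A) :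
    (visitCount ω s a : ℝ) = ∑ i : Fin t, ∑ h : Fin (H - 1),
      if ω i ⟨h.1, by omega⟩ = (s, a) then (1 : ℝ) else 0 := by
  simp [visitCount]

theorem sum_transCount (ω : Fin t → Traj S A H) (s : Fin S) (a : Fin A) :
    ∑ s', (transCount ω s a s' : ℝ) = visitCount ω s a := by
  have h := sum_transCount_mul ω s a fun _ => (1 : ℝ)
  simp only [one_mul] at h
  rw [h, visitCount_eq_sum]

theorem visitCount_le (ω : Fin t → Traj S A H) (s : Fin S) (a : Fin A) :
    visitCount ω s a ≤ t * H := by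
  unfold visitCount
  refine (Finset.sum_le_sum fun i _ => Finset.sum_le_sum fun h _ =>
    (show _ ≤ 1 by split_ifs <;> simp)).trans ?_
  simp only [Finset.sum_const, Finset.card_univ, Fintype.card_fin, smul_eq_mul, mul_one]
  exact Nat.mul_le_mul_left _ (Nat.sub_le _ _)

theorem empTrans_nonneg (ω : Fin t → Traj S A H) (s : Fin S) (a : Fin A) (s' : Fin S) :
    0 ≤ empTrans ω s a s' := by
  unfold empTrans
  split_ifs <;> positivity

theorem sum_empTrans (ω : Fin t → Traj S A H) (s : Fin S) (a : Fin A) :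
    ∑ s', empTrans ω s a s' = 1 := by
  unfold empTrans
  split_ifs with h
  · have : (S : ℝ) ≠ 0 := Nat.cast_ne_zero.2 (Fin.pos s).ne'
    simp [this]
  · rw [← Finset.sum_div, sum_transCount, div_self (Nat.cast_ne_zero.2 h)]

variable {ρ : stdSimplex ℝ (Fin S)} {P : TransFn S A} {L : Learner S A H}

/-- Chernoff's bound with parameter `ε`. The number of visits is random, but on the event it equals
`m`, so the exponent of the supermartingale is at least `m * ε ^ 2 - m * ε ^ 2 / 2`. -/
theorem eventProb_deviation_le {f : Fin S → ℝ} (hf : ∀ s', f s' ∈ Set.Icc (-1 : ℝ) 1)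
    (s : Fin S) (a : Fin A) (m : ℕ) {ε : ℝ} (hε : 0 ≤ ε) :
    eventProb ρ P L {ω : Fin t → Traj S A H | visitCount ω s a = m ∧
      m * ε ≤ ∑ s', f s' * (transCount ω s a s' - m * (P s a).1 s')} ≤
      Real.exp (-(m * ε ^ 2 / 2)) := by
  rw [Real.exp_neg]
  refine sum_indicator_le_inv (runProb_nonneg ρ P L) (fun ω => Real.exp_nonneg _)
    (sum_runProb_mul_exp_le_one ρ P L _ fun t ω =>
      sum_trajProb_mul_exp_le_one ρ P (L t.1 ω).2 hf ε s a) (Real.exp_pos _) ?_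
  have h1 (h : Fin (H - 1)) : h.1 < H := Nat.lt_of_lt_pred h.2
  have h2 (h : Fin (H - 1)) : h.1 + 1 < H := Nat.add_lt_of_lt_sub h.2
  have h3 (ω : Fin t → Traj S A H) (i : Fin t) (h : Fin (H - 1)) : (if ω i ⟨h.1, h1 h⟩ = (s, a) then
        ε * (f (ω i ⟨h.1 + 1, h2 h⟩).1 - ∑ s', (P s a).1 s' * f s') - ε ^ 2 / 2 else 0) =
      ε * (if ω i ⟨h.1, h1 h⟩ = (s, a) then f (ω i ⟨h.1 + 1, h2 h⟩).1 else 0) -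
        (ε * (∑ s', (P s a).1 s' * f s') + ε ^ 2 / 2) *
          (if ω i ⟨h.1, h1 h⟩ = (s, a) then (1 : ℝ) else 0) := by
    split_ifs <;> ring
  rintro ω ⟨hm, hω⟩
  rw [Real.exp_le_exp]
  simp only [h3, Finset.sum_sub_distrib, ← Finset.mul_sum]
  rw [← visitCount_eq_sum, ← sum_transCount_mul, hm]
  have h2 : ∑ s', f s' * (transCount ω s a s' - m * (P s a).1 s') =
      ∑ s', f s' * transCount ω s a s' - m * ∑ s', (P s a).1 s' * f s' := by
    rw [Finset.mul_sum, ← Finset.sum_sub_distrib]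
    exact Finset.sum_congr rfl fun s' _ => by ring
  rw [h2] at hω
  have h3 := mul_le_mul_of_nonneg_left hω hε
  linarith

theorem exists_deviation_of_notMem_confSet (hS : 2 ≤ S) (ht : 0 < t) {δ : ℝ} (hδ : 0 < δ)
    (hδ1 : δ ≤ 1) {ω : Fin t → Traj S A H} (h : P ∉ confSet δ ω) :
    ∃ (s : Fin S) (a : Fin A) (b : Fin S → Bool) (m : ℕ), m ∈ Finset.Icc 1 (t * H) ∧
      visitCount ω s a = m ∧ m * √(4 * S * Real.log (S * A * t / δ) / m) ≤
        ∑ s', (if b s' then 1 else -1) * (transCount ω s a s' - m * (P s a).1 s') := by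
  simp only [confSet, Set.mem_ofPred_eq, not_forall, not_le] at h
  obtain ⟨-, s, a, h⟩ := h
  have hS' : (2 : ℝ) ≤ S := by exact_mod_cast hS
  have hA' : (1 : ℝ) ≤ A := by exact_mod_cast (Fin.pos a)
  have ht' : (1 : ℝ) ≤ t := by exact_mod_cast ht
  -- At an unvisited pair the radius is at least `2`, the largest possible L1 distance, so the
  -- constraint cannot fail there. This uses `S ≥ 2`.
  have hm0 : visitCount ω s a ≠ 0 := by
    intro h0
    rw [h0, Nat.cast_zero, max_eq_left zero_le_one, div_one] at h
    have h2 : ∑ s', |(P s a).1 s' - empTrans ω s a s'| ≤ 2 := by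
      refine (Finset.sum_le_sum fun s' _ => abs_sub _ _).trans ?_
      simp only [abs_of_nonneg ((P s a).2.1 _), abs_of_nonneg (empTrans_nonneg ω s a _)]
      rw [Finset.sum_add_distrib, (P s a).2.2, sum_empTrans]
      norm_num
    have h3 : (1 : ℝ) / 2 ≤ Real.log (S * A * t / δ) := by
      have hlog2 := Real.log_two_gt_d9
      refine le_trans ?_ (Real.log_le_log two_pos (y := S * A * t / δ) ?_)
      · linarith
      · rw [le_div_iff₀ hδ]
        have : (2 : ℝ) * 1 * 1 ≤ S * A * t := by gcongr
        linarith
    have h4 : (2 : ℝ) ≤ √(4 * S * Real.log (S * A * t / δ)) := by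
      refine Real.le_sqrt_of_sq_le ?_
      have : (2 : ℝ) * (1 / 2) ≤ S * Real.log (S * A * t / δ) := by gcongr
      linarith
    linarith
  have hm1 : (1 : ℝ) ≤ visitCount ω s a := by exact_mod_cast Nat.one_le_iff_ne_zero.2 hm0
  have hm : (0 : ℝ) < visitCount ω s a := by linarith
  -- The signs of the deviations turn the L1 norm into a linear functional of the counts.
  refine ⟨s, a, fun s' => decide (0 ≤ (transCount ω s a s' : ℝ) - visitCount ω s a * (P s a).1 s'),
    visitCount ω s a, Finset.mem_Icc.2 ⟨Nat.one_le_iff_ne_zero.2 hm0, visitCount_le ω s a⟩, rfl, ?_⟩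
  rw [max_eq_right hm1] at h
  refine (mul_le_mul_of_nonneg_left h.le hm.le).trans_eq ?_
  rw [Finset.mul_sum]
  refine Finset.sum_congr rfl fun s' _ => ?_
  have h1 : (if decide (0 ≤ (transCount ω s a s' : ℝ) - visitCount ω s a * (P s a).1 s') then
      (1 : ℝ) else -1) * (transCount ω s a s' - visitCount ω s a * (P s a).1 s') =
      |(transCount ω s a s' : ℝ) - visitCount ω s a * (P s a).1 s'| := by
    by_cases hs : 0 ≤ (transCount ω s a s' : ℝ) - visitCount ω s a * (P s a).1 s'
    · rw [abs_of_nonneg hs]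
      simp [hs]
    · rw [abs_of_neg (not_le.1 hs)]
      simp [hs]
  rw [h1, empTrans, if_neg hm0, abs_sub_comm]
  nth_rw 1 [← abs_of_pos hm]
  rw [← abs_mul]
  congr 1
  field_simp

theorem mem_confSet_of_lt_two (hS : S < 2) (δ : ℝ) (ω : Fin t → Traj S A H) :
    P ∈ confSet δ ω := by
  intro _ s a
  obtain rfl : S = 1 := by have := Fin.pos s; omega
  have h1 := (P s a).2.2
  have h2 := sum_empTrans ω s a
  rw [Fin.sum_univ_one] at h1 h2 ⊢
  rw [h1, h2, sub_self, abs_zero]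
  exact Real.sqrt_nonneg _

/-- With `y = S * A * t / δ` the left side is `δ * y * H * (2 / y ^ 2) ^ S`. As `2 / y ^ 2 ≤ 1` and
`S ≥ 2`, the exponent `S` may be lowered to `2`, and `y ≥ 2 * t` finishes. -/
theorem confidence_failure_le {S A t H : ℕ} {δ : ℝ} (hS : 2 ≤ S) (hA : 0 < A) (ht : 0 < t)
    (hδ : 0 < δ) (hδ1 : δ ≤ 1) :
    (S * A * 2 ^ S * (t * H) : ℝ) * Real.exp (-(2 * S * Real.log (S * A * t / δ))) ≤
      δ * H / (2 * t ^ 3) := by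
  have hS' : (2 : ℝ) ≤ S := by exact_mod_cast hS
  have hA' : (1 : ℝ) ≤ A := by exact_mod_cast hA
  have ht' : (1 : ℝ) ≤ t := by exact_mod_cast ht
  set y : ℝ := S * A * t / δ with hy
  have hyt : 2 * t ≤ y := by
    rw [hy, le_div_iff₀ hδ]
    have h1 : (2 : ℝ) * 1 * t ≤ S * A * t := by gcongr
    have h2 : 2 * (t : ℝ) * δ ≤ 2 * t * 1 := by gcongr
    linarith
  have hy0 : 0 < y := by linarith
  have hexp : Real.exp (-(2 * S * Real.log y)) = (1 / y ^ 2) ^ S := by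
    have h := Real.exp_nat_mul (Real.log y) (2 * S)
    push_cast at h
    rw [Real.exp_neg, h, Real.exp_log hy0, pow_mul, one_div, inv_pow]
  rw [hexp]
  have h2y : 2 * (1 / y ^ 2) ≤ 1 := by
    rw [mul_one_div, div_le_one (by positivity)]
    nlinarith
  calc (S * A * 2 ^ S * (t * H) : ℝ) * (1 / y ^ 2) ^ S
      = δ * y * H * (2 * (1 / y ^ 2)) ^ S := by
        rw [mul_pow, hy]
        field_simp
    _ ≤ δ * y * H * (2 * (1 / y ^ 2)) ^ 2 := by
        gcongr ?_ * ?_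
        exact pow_le_pow_of_le_one (by positivity) h2y hS
    _ = 4 * δ * H / y ^ 3 := by
        field_simp
        ring
    _ ≤ 4 * δ * H / (2 * t) ^ 3 := by gcongr
    _ = δ * H / (2 * t ^ 3) := by
        field_simp
        ring

/-- The union runs over `S * A` pairs, `2 ^ S` sign vectors and `t * H` positive counts. The radius
makes each term `exp (-2 S log (S A t / δ))`, whatever the count. For a single state there is
nothing to estimate. -/
theorem eventProb_notMem_confSet_le (hA : 0 < A) (ht : 0 < t) {δ : ℝ} (hδ : 0 < δ)
    (hδ1 : δ ≤ 1) :
    eventProb ρ P L {ω : Fin t → Traj S A H | P ∉ confSet δ ω} ≤ δ * H / (2 * t ^ 3) := by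
  rcases lt_or_ge S 2 with hS | hS
  · refine le_of_eq_of_le (Finset.sum_eq_zero fun ω _ => Set.indicator_of_notMem ?_ _)
      (by positivity)
    exact not_not.2 (mem_confSet_of_lt_two hS δ ω)
  · set ε : ℕ → ℝ := fun m => √(4 * S * Real.log (S * A * t / δ) / m) with hε
    have hlog : 0 ≤ Real.log (S * A * t / δ) := by
      refine Real.log_nonneg ?_
      rw [le_div_iff₀ hδ, one_mul]
      refine hδ1.trans ?_
      exact_mod_cast Nat.mul_pos (Nat.mul_pos (by omega) hA) ht
    refine (eventProb_le_sum ((Finset.univ : Finset (Fin S × Fin A × (Fin S → Bool))) ×ˢ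
      Finset.Icc 1 (t * H)) (fun i => {ω | visitCount ω i.1.1 i.1.2.1 = i.2 ∧ i.2 * ε i.2 ≤
        ∑ s', (if i.1.2.2 s' then 1 else -1) *
          (transCount ω i.1.1 i.1.2.1 s' - i.2 * (P i.1.1 i.1.2.1).1 s')}) fun ω hω => ?_).trans ?_
    · obtain ⟨s, a, b, m, hm, h⟩ := exists_deviation_of_notMem_confSet hS ht hδ hδ1 hω
      exact ⟨((s, a, b), m), Finset.mem_product.2 ⟨Finset.mem_univ _, hm⟩, h⟩
    · refine le_trans ?_ (confidence_failure_le (H := H) hS hA ht hδ hδ1)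
      refine (Finset.sum_le_card_nsmul _ _
        (Real.exp (-(2 * S * Real.log (S * A * t / δ)))) fun i hi => ?_).trans_eq ?_
      · refine (eventProb_deviation_le (fun s' => ?_) i.1.1 i.1.2.1 i.2
          (Real.sqrt_nonneg _)).trans_eq ?_
        · split_ifs <;> norm_num
        · have hm : (0 : ℝ) < i.2 := by
            exact_mod_cast (Finset.mem_Icc.1 (Finset.mem_product.1 hi).2).1
          rw [Real.sq_sqrt (by positivity)]
          congr 2
          field_simp
          ring
      · rw [Finset.card_product, Finset.card_univ]
        simp only [Fintype.card_prod, Fintype.card_fun, Fintype.card_fin, Fintype.card_bool,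
          Nat.card_Icc, Nat.add_sub_cancel, nsmul_eq_mul]
        push_cast
        ring

end Confidence

/-! ### Pigeonhole bound for the bonuses, and optimism -/

section Bonus

variable {S A n H T : ℕ}

theorem visitCount_succ (ω : Fin (T + 1) → Traj S A H) (s : Fin S) (a : Fin A) :
    visitCount ω s a = visitCount (fun i : Fin T => ω i.castSucc) s a +
      ∑ h : Fin (H - 1), if ω (Fin.last T) ⟨h.1, by omega⟩ = (s, a) then 1 else 0 :=
  Fin.sum_univ_castSucc _

/-- Here `N` counts the visits before an episode and `k` those within it. Factor `k = (√(N + k) -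
√N) * (√(N + k) + √N)`; the second factor exceeds `√(max 1 N)` by at most `2 * √(1 + H)`, the price
of updating counts only between episodes. The first factor telescopes. -/
theorem div_sqrt_max_le {N k H : ℕ} (hk : k ≤ H) :
    (k : ℝ) * (1 / √(max 1 (N : ℝ))) ≤ 2 * √(1 + H) * (√((N + k : ℕ) : ℝ) - √N) := by
  have hk' : (k : ℝ) ≤ H := by exact_mod_cast hk
  have hM1 : (1 : ℝ) ≤ max 1 (N : ℝ) := le_max_left _ _
  have hM : (0 : ℝ) < √(max 1 (N : ℝ)) := Real.sqrt_pos.2 (by linarith)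
  have hmono : √(N : ℝ) ≤ √((N + k : ℕ) : ℝ) := Real.sqrt_le_sqrt (by push_cast; linarith)
  rw [mul_one_div, div_le_iff₀ hM]
  have h1 : √((N + k : ℕ) : ℝ) ≤ √(1 + H) * √(max 1 (N : ℝ)) := by
    rw [← Real.sqrt_mul (by positivity)]
    refine Real.sqrt_le_sqrt ?_
    push_cast
    nlinarith [le_max_right (1 : ℝ) N, (Nat.cast_nonneg H : (0 : ℝ) ≤ H)]
  calc (k : ℝ) = (√((N + k : ℕ) : ℝ) - √N) * (√((N + k : ℕ) : ℝ) + √N) := by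
        rw [mul_comm, ← sq_sub_sq, Real.sq_sqrt (Nat.cast_nonneg _),
          Real.sq_sqrt (Nat.cast_nonneg _)]
        push_cast
        ring
    _ ≤ (√((N + k : ℕ) : ℝ) - √N) * (2 * (√(1 + H) * √(max 1 (N : ℝ)))) := by
        refine mul_le_mul_of_nonneg_left ?_ (sub_nonneg.2 hmono)
        linarith
    _ = _ := by ring

theorem sum_visits_div_sqrt_le : ∀ {T : ℕ} (ω : Fin T → Traj S A H) (s : Fin S) (a : Fin A),
    ∑ t : Fin T, ∑ h : Fin (H - 1), (if ω t ⟨h.1, by omega⟩ = (s, a) then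
      1 / √(max 1 (visitCount (fun i => ω (Fin.castLE t.2.le i)) s a : ℝ)) else 0) ≤
      2 * √(1 + H) * √(visitCount ω s a)
  | 0, ω, s, a => by simp [visitCount]
  | T + 1, ω, s, a => by
    have ih := sum_visits_div_sqrt_le (fun i : Fin T => ω i.castSucc) s a
    rw [Fin.sum_univ_castSucc, visitCount_succ]
    set k : ℕ := ∑ h : Fin (H - 1), if ω (Fin.last T) ⟨h.1, by omega⟩ = (s, a) then 1 else 0
      with hk
    have hkH : k ≤ H := by
      refine (Finset.sum_le_sum fun h _ => (show _ ≤ 1 by split_ifs <;> simp)).trans ?_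
      simp
    have hstep := div_sqrt_max_le (N := visitCount (fun i : Fin T => ω i.castSucc) s a) hkH
    have hlast : ∑ h : Fin (H - 1), (if ω (Fin.last T) ⟨h.1, by omega⟩ = (s, a) then
        1 / √(max 1 (visitCount (fun i : Fin T => ω i.castSucc) s a : ℝ)) else 0) =
        (k : ℝ) * (1 / √(max 1 (visitCount (fun i : Fin T => ω i.castSucc) s a : ℝ))) := by
      rw [hk]
      push_cast
      rw [Finset.sum_mul]
      exact Finset.sum_congr rfl fun h _ => by split_ifs <;> simp
    rw [mul_sub] at hstep
    exact (add_le_add ih (hlast.le.trans hstep)).trans (by linarith)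

theorem sum_visitCount_le (ω : Fin T → Traj S A H) :
    ∑ x : Fin S × Fin A, (visitCount ω x.1 x.2 : ℝ) ≤ T * H := by
  simp only [visitCount_eq_sum]
  have h1 : ∑ x : Fin S × Fin A, ∑ i : Fin T, ∑ h : Fin (H - 1),
      (if ω i ⟨h.1, by omega⟩ = (x.1, x.2) then (1 : ℝ) else 0) =
      ∑ i : Fin T, ∑ h : Fin (H - 1), 1 := by
    rw [Finset.sum_comm]
    refine Finset.sum_congr rfl fun i _ => ?_
    rw [Finset.sum_comm]
    refine Finset.sum_congr rfl fun h _ => ?_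
    simp only [Prod.mk.eta, Finset.sum_ite_eq, Finset.mem_univ, if_true]
  rw [h1]
  simp only [Finset.sum_const, Finset.card_univ, Fintype.card_fin, nsmul_eq_mul, mul_one]
  gcongr
  exact Nat.sub_le _ _

theorem sum_one_div_sqrt_visitCount_le (ω : Fin T → Traj S A H) :
    ∑ t : Fin T, ∑ h : Fin (H - 1), 1 / √(max 1 (visitCount (fun i => ω (Fin.castLE t.2.le i))
      (ω t ⟨h.1, by omega⟩).1 (ω t ⟨h.1, by omega⟩).2 : ℝ)) ≤
      2 * √(1 + H) * √(S * A * (T * H)) := by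
  trans ∑ x : Fin S × Fin A, ∑ t : Fin T, ∑ h : Fin (H - 1),
        (if ω t ⟨h.1, by omega⟩ = (x.1, x.2) then
          1 / √(max 1 (visitCount (fun i => ω (Fin.castLE t.2.le i)) x.1 x.2 : ℝ)) else 0)
  · refine Eq.ge ?_
    rw [Finset.sum_comm]
    refine Finset.sum_congr rfl fun t _ => ?_
    rw [Finset.sum_comm]
    refine Finset.sum_congr rfl fun h _ => ?_
    simp only [Prod.mk.eta, Finset.sum_ite_eq, Finset.mem_univ, if_true]
  · refine (Finset.sum_le_sum fun x _ => sum_visits_div_sqrt_le ω x.1 x.2).trans ?_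
    rw [← Finset.mul_sum]
    refine mul_le_mul_of_nonneg_left ?_ (by positivity)
    -- Cauchy-Schwarz over the `S * A` pairs, whose counts sum to at most `T * H`.
    refine Real.le_sqrt_of_sq_le (sq_sum_le_card_mul_sum_sq.trans ?_)
    simp only [Real.sq_sqrt (Nat.cast_nonneg _), Finset.card_univ, Fintype.card_prod,
      Fintype.card_fin, Nat.cast_mul]
    exact mul_le_mul_of_nonneg_left (sum_visitCount_le ω) (by positivity)

/-- A bound for the sum of the distances between two models of a confidence set along the episode
`τ`, when the confidence set is computed from the episodes `ω` and has logarithmic factor `l`. -/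
def bonus (l : ℝ) (ω : Fin T → Traj S A H) (τ : Traj S A H) : ℝ :=
  ∑ h : Fin (H - 1), min 2 (2 * √(4 * S * l /
    max 1 (visitCount ω (τ ⟨h.1, by omega⟩).1 (τ ⟨h.1, by omega⟩).2 : ℝ)))

/-- The truncation at `2` in `bonus` gives Azuma-Hoeffding a range free of `S` and of logarithms. -/
theorem bonus_mem_Icc (l : ℝ) (ω : Fin T → Traj S A H) (τ : Traj S A H) :
    bonus l ω τ ∈ Set.Icc (0 : ℝ) (2 * H) := by
  refine ⟨Finset.sum_nonneg fun h _ => by positivity, ?_⟩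
  refine (Finset.sum_le_sum fun h _ => min_le_left _ _).trans ?_
  simp only [Finset.sum_const, Finset.card_univ, Fintype.card_fin, nsmul_eq_mul, mul_comm (2 : ℝ)]
  gcongr
  exact Nat.sub_le _ _

theorem sum_bonus_le {l : ℝ} (hl : 0 ≤ l) (hH : 0 < H) (ω : Fin T → Traj S A H) :
    ∑ t : Fin T, bonus l (fun i => ω (Fin.castLE t.2.le i)) (ω t) ≤
      12 * (S * H) * (√(A * T) * √l) := by
  have hH' : (1 : ℝ) ≤ H := by exact_mod_cast hH
  have hl4 : 0 ≤ 4 * S * l := by positivity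
  calc _ ≤ ∑ t : Fin T, ∑ h : Fin (H - 1), 2 * √(4 * S * l) *
        (1 / √(max 1 (visitCount (fun i => ω (Fin.castLE t.2.le i))
          (ω t ⟨h.1, by omega⟩).1 (ω t ⟨h.1, by omega⟩).2 : ℝ))) := by
        refine Finset.sum_le_sum fun t _ => Finset.sum_le_sum fun h _ => ?_
        refine (min_le_right _ _).trans_eq ?_
        rw [Real.sqrt_div hl4]
        ring
    _ ≤ 2 * √(4 * S * l) * (2 * √(1 + H) * √(S * A * (T * H))) := by
        simp only [← Finset.mul_sum]
        exact mul_le_mul_of_nonneg_left (sum_one_div_sqrt_visitCount_le ω) (by positivity)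
    _ ≤ 2 * √(4 * S * l) * (2 * √(2 * H) * √(S * A * (T * H))) := by
        gcongr
        linarith
    _ = 4 * √8 * (S * H) * (√(A * T) * √l) := by
        have h1 : 4 * S * l * (2 * H) * (S * A * (T * H)) = (S * H) ^ 2 * (8 * (A * T * l)) := by
          ring
        have h2 : √(4 * S * l) * √(2 * H) * √(S * A * (T * H)) =
            (S * H) * (√8 * (√(A * T) * √l)) := by
          rw [← Real.sqrt_mul hl4, ← Real.sqrt_mul (by positivity), h1,
            Real.sqrt_mul (by positivity), Real.sqrt_sq (by positivity),
            Real.sqrt_mul (by positivity), Real.sqrt_mul (by positivity)]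
        linear_combination 4 * h2
    _ ≤ _ := by
        have h8 : √(8 : ℝ) ≤ 3 := Real.sqrt_le_iff.2 ⟨by norm_num, by norm_num⟩
        gcongr
        linarith

variable {ρ : stdSimplex ℝ (Fin S)} {P : TransFn S A} {r : Rewards S A n} {δ : ℝ}
  {L : Learner S A H}

theorem sum_abs_sub_le_two (p q : stdSimplex ℝ (Fin S)) : ∑ s, |p.1 s - q.1 s| ≤ 2 := by
  refine (Finset.sum_le_sum fun s _ => abs_sub _ _).trans ?_
  simp only [abs_of_nonneg (p.2.1 _), abs_of_nonneg (q.2.1 _)]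
  rw [Finset.sum_add_distrib, p.2.2, q.2.2]
  norm_num

/-- Optimism: the true model competes in the learner's maximization, and both models lie within one
radius of the empirical one, hence the factor `2` in `bonus`. The free `l` allows one logarithm for
all episodes. -/
theorem optWelfare_sub_le {t : ℕ} (hn : 0 < n) (hr : ∀ i s a, 0 ≤ r i s a ∧ r i s a ≤ 1)
    (hL : IsUCRL ρ r δ L) (ht : 0 < t) {ω : Fin t → Traj S A H} (hP : P ∈ confSet δ ω) {l : ℝ}
    (hl : Real.log (S * A * t / δ) ≤ l) :
    optWelfare H ρ r P - minWelfare ρ r P (L t ω).2 ≤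
      H * ∑ τ, trajProb ρ P (L t ω).2 τ * bonus l ω τ := by
  obtain ⟨hmem, hopt, hpol⟩ := hL t ω
  have : Nonempty (Policy S A H) := ⟨(L t ω).2⟩
  have h1 : optWelfare H ρ r P ≤ minWelfare ρ r (L t ω).1 (L t ω).2 :=
    (hopt P hP).trans (ciSup_le hpol)
  have key (s : Fin S) (a : Fin A) : ∑ s', |(P s a).1 s' - ((L t ω).1 s a).1 s'| ≤
      2 * √(4 * S * l / max 1 (visitCount ω s a : ℝ)) := by
    have h2 : √(4 * S * Real.log (S * A * t / δ) / max 1 (visitCount ω s a : ℝ)) ≤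
        √(4 * S * l / max 1 (visitCount ω s a : ℝ)) := by
      gcongr
    have h3 : ∑ s', |(P s a).1 s' - ((L t ω).1 s a).1 s'| ≤
        ∑ s', |(P s a).1 s' - empTrans ω s a s'| +
          ∑ s', |((L t ω).1 s a).1 s' - empTrans ω s a s'| := by
      rw [← Finset.sum_add_distrib]
      refine Finset.sum_le_sum fun s' _ => ?_
      rw [abs_sub_comm (((L t ω).1 s a).1 s')]
      exact abs_sub_le _ _ _
    have h4 := hP ht s a
    have h5 := hmem ht s a
    linarith
  refine (sub_le_sub_right h1 _).trans ((minWelfare_sub_le hn hr _).trans ?_)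
  refine mul_le_mul_of_nonneg_left ((sum_abs_trajProb_sub_le ρ P _ _).trans ?_) (Nat.cast_nonneg H)
  refine Finset.sum_le_sum fun τ _ => mul_le_mul_of_nonneg_left ?_ (trajProb_nonneg ρ P _ τ)
  refine Finset.sum_le_sum fun h _ => le_min (sum_abs_sub_le_two _ _) (key _ _)

end Bonus

/-! ### Assembling the regret bound -/

section Regret

variable {S A n H T : ℕ} {ρ : stdSimplex ℝ (Fin S)} {P : TransFn S A} {r : Rewards S A n} {δ : ℝ}
  {L : Learner S A H}

/-- With high probability the true model is in the confidence sets of all episodes after the first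
`H`. -/
theorem eventProb_exists_notMem_confSet_le (hA : 0 < A) (hH : 0 < H) (hδ : 0 < δ) (hδ1 : δ ≤ 1) :
    eventProb ρ P L {ω : Fin T → Traj S A H | ∃ t : ℕ, ∃ h : t ≤ T, H < t ∧
      P ∉ confSet δ fun i : Fin t => ω (Fin.castLE h i)} ≤ δ / 2 := by
  refine (eventProb_le_sum (Finset.Ioc H T) (fun t => {ω | ∃ h : t ≤ T,
    (fun i => ω (Fin.castLE h i)) ∈ {ω : Fin t → Traj S A H | P ∉ confSet δ ω}})
    fun ω hω => ?_).trans ?_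
  · obtain ⟨t, h, ht, hP⟩ := hω
    exact ⟨t, Finset.mem_Ioc.2 ⟨ht, h⟩, h, hP⟩
  refine (Finset.sum_le_sum (g := fun t : ℕ => δ / 2 * ((t : ℝ) ^ 2)⁻¹) fun t ht => ?_).trans ?_
  · obtain ⟨hHt, htT⟩ := Finset.mem_Ioc.1 ht
    simp only [htT, exists_true_left]
    rw [eventProb_prefix htT]
    have ht0 : 0 < t := by omega
    refine (eventProb_notMem_confSet_le hA ht0 hδ hδ1).trans ?_
    have h1 : (0 : ℝ) < t := Nat.cast_pos.2 ht0
    -- Restricting to `t > H` trades the factor `H` for a `t`, leaving a summable `1 / t ^ 2`.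
    have h2 : (H : ℝ) ≤ t := Nat.cast_le.2 hHt.le
    calc δ * H / (2 * t ^ 3) ≤ δ * t / (2 * t ^ 3) := by gcongr
      _ = δ / 2 * ((t : ℝ) ^ 2)⁻¹ := by
        field_simp
  · rw [← Finset.mul_sum]
    refine mul_le_of_le_one_right (by positivity) ?_
    rcases le_total H T with h | h
    · refine (sum_Ioc_inv_sq_le_sub hH.ne' h).trans ?_
      have h1 : ((H : ℝ))⁻¹ ≤ 1 := inv_le_one_of_one_le₀ (by exact_mod_cast hH)
      have h2 : (0 : ℝ) ≤ (T : ℝ)⁻¹ := by positivity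
      linarith
    · rw [Finset.Ioc_eq_empty_of_le h, Finset.sum_empty]
      exact zero_le_one

theorem sum_ite_le_horizon :
    ∑ t : Fin T, (if t.1 ≤ H then (H : ℝ) else 0) ≤ (H + 1) * H := by
  rw [Fin.sum_univ_eq_sum_range (fun t => if t ≤ H then (H : ℝ) else 0) T, ← Finset.sum_filter,
    Finset.sum_const, nsmul_eq_mul]
  gcongr
  have : ((Finset.range T).filter (· ≤ H)).card ≤ (Finset.range (H + 1)).card :=
    Finset.card_le_card fun t ht => by
      have := (Finset.mem_filter.1 ht).2
      exact Finset.mem_range.2 (by omega)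
  rw [Finset.card_range] at this
  exact_mod_cast this

/-- Episodes with index at most `H`, counted from `0`, are charged the trivial `H`; optimism handles
the others. -/
theorem regret_le (hn : 0 < n) (hH : 0 < H) (hA : 0 < A)
    (hr : ∀ i s a, 0 ≤ r i s a ∧ r i s a ≤ 1) (hδ : 0 < δ) (hL : IsUCRL ρ r δ L)
    {ω : Fin T → Traj S A H}
    (hω : ∀ (t : ℕ) (h : t ≤ T), H < t → P ∈ confSet δ fun i : Fin t => ω (Fin.castLE h i)) :
    regret ρ r P L ω ≤ H * (∑ t : Fin T, ∑ τ, trajProb ρ P (playedPolicy L ω t) τ *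
      bonus (Real.log (S * A * T / δ)) (fun i => ω (Fin.castLE t.2.le i)) τ) + (H + 1) * H := by
  refine le_trans ?_ (add_le_add_right (sum_ite_le_horizon (T := T)) _)
  rw [regret, Finset.mul_sum, ← Finset.sum_add_distrib]
  refine Finset.sum_le_sum fun t _ => ?_
  split_ifs with htH
  · have h1 := optWelfare_le (ρ := ρ) (P := P) hn hr (playedPolicy L ω t)
    have h2 := (minWelfare_mem_Icc (ρ := ρ) (P := P) (π := playedPolicy L ω t) hn hr).1
    have h3 : 0 ≤ H * ∑ τ, trajProb ρ P (playedPolicy L ω t) τ *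
        bonus (Real.log (S * A * T / δ)) (fun i => ω (Fin.castLE t.2.le i)) τ :=
      mul_nonneg (Nat.cast_nonneg H) (Finset.sum_nonneg fun τ _ =>
        mul_nonneg (trajProb_nonneg ρ P _ τ) (bonus_mem_Icc _ _ τ).1)
    linarith
  · rw [add_zero]
    refine optWelfare_sub_le hn hr hL (by omega) (hω t.1 t.2.le (by omega)) ?_
    have hS : 0 < S := Fin.pos (ω t ⟨0, hH⟩).1
    have ht0 : 0 < t.1 := by omega
    refine Real.log_le_log (by positivity) ?_
    gcongr
    exact t.2.le

theorem log_two_div_le (hS : 0 < S) (hA : 0 < A) (hT : 0 < T) (hδ : 0 < δ) :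
    Real.log (1 / (δ / 2)) ≤ 1 + Real.log (S * A * T / δ) := by
  have h1 : (1 : ℝ) ≤ S * A * T := by exact_mod_cast Nat.mul_pos (Nat.mul_pos hS hA) hT
  have h2 : 1 / (δ / 2) = 2 * (1 / δ) := by field_simp
  rw [h2, Real.log_mul two_ne_zero (by positivity)]
  have h3 : Real.log (1 / δ) ≤ Real.log (S * A * T / δ) :=
    Real.log_le_log (by positivity) (by gcongr)
  have h4 := Real.log_two_lt_d9
  linarith

/-- Here `x` stands for `√(A * T)`, `e1` and `e2` for the realised and expected total bonus, `m` for
the Azuma deviation and `u` for the regret. The constant is `16 = 12 + 2 + 2`: bonuses, deviation,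
initial episodes. -/
theorem regret_bound_arith {h s x u l m e1 e2 : ℝ} (hh : 1 ≤ h) (hs : 1 ≤ s) (hx : 1 ≤ x)
    (hl : 0 ≤ l) (he1 : e1 ≤ 12 * (s * h) * (x * √l)) (hm : m ≤ x * √(1 + l))
    (he2 : e2 ≤ e1 + 2 * h * m) (hu : u ≤ h * e2 + (h + 1) * h) :
    u ≤ 16 * h ^ 2 * s * x * (1 + l) := by
  have h1 : √l ≤ 1 + l := Real.sqrt_le_iff.2 ⟨by linarith, by nlinarith⟩
  have h2 : √(1 + l) ≤ 1 + l := Real.sqrt_le_iff.2 ⟨by linarith, by nlinarith⟩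
  set q : ℝ := x * (1 + l) with hq
  have hq1 : 1 ≤ q := by nlinarith
  have h3 : x * √l ≤ q := mul_le_mul_of_nonneg_left h1 (by linarith)
  have h4 : x * √(1 + l) ≤ q := mul_le_mul_of_nonneg_left h2 (by linarith)
  have h5 : q ≤ s * q := by nlinarith
  have h6 : e2 ≤ 14 * h * (s * q) := by
    have h7 : 12 * (s * h) * (x * √l) ≤ 12 * (s * h) * q := by gcongr
    have h8 : 2 * h * m ≤ 2 * h * (s * q) := by
      gcongr
      linarith
    linarith
  have h9 : h * e2 ≤ h * (14 * h * (s * q)) := by gcongr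
  have h10 : (h + 1) * h ≤ 2 * h ^ 2 * (s * q) := by
    have : (h + 1) * h ≤ 2 * h ^ 2 * 1 := by nlinarith
    refine this.trans ?_
    gcongr
    linarith
  calc u ≤ h * (14 * h * (s * q)) + 2 * h ^ 2 * (s * q) := by linarith
    _ = _ := by rw [hq]; ring

theorem eventProb_regret_le_of_pos (hn : 0 < n) (hH : 0 < H) (hT : 0 < T)
    (hr : ∀ i s a, 0 ≤ r i s a ∧ r i s a ≤ 1) (hδ : 0 < δ) (hδ1 : δ < 1)
    (hL : IsUCRL ρ r δ L) :
    1 - δ ≤ eventProb ρ P L {ω : Fin T → Traj S A H | regret ρ r P L ω ≤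
      16 * H ^ 2 * S * √(A * T) * (1 + Real.log (S * A * T / δ))} := by
  have hS : 0 < S := by
    rcases Nat.eq_zero_or_pos S with rfl | h
    · have := ρ.2.2
      simp at this
    · exact h
  -- The learner outputs a policy, hence a distribution on actions, so there is at least one action.
  have hA : 0 < A := by
    rcases Nat.eq_zero_or_pos A with rfl | h
    · have := ((L 0 Fin.elim0).2 ⟨0, hH⟩ ⟨0, hS⟩).2.2
      simp at this
    · exact h
  have hA' : (1 : ℝ) ≤ A := by exact_mod_cast hA
  have hT' : (1 : ℝ) ≤ T := by exact_mod_cast hT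
  set l : ℝ := Real.log (S * A * T / δ) with hl
  have hl0 : 0 ≤ l := by
    refine Real.log_nonneg ?_
    rw [le_div_iff₀ hδ, one_mul]
    refine hδ1.le.trans ?_
    exact_mod_cast Nat.mul_pos (Nat.mul_pos hS hA) hT
  rw [eventProb_compl]
  refine sub_le_sub_left ?_ 1
  -- The two bad events, a confidence failure and an Azuma deviation, have probability at most `δ /
  -- 2` each.
  let F : Bool → Set (Fin T → Traj S A H) := fun i => if i then
      {ω | ∃ t : ℕ, ∃ h : t ≤ T, H < t ∧ P ∉ confSet δ fun i : Fin t => ω (Fin.castLE h i)}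
    else {ω | 2 * H * √(T * Real.log (1 / (δ / 2)) / 2) <
      ∑ t : Fin T, ((∑ τ, trajProb ρ P (playedPolicy L ω t) τ *
        bonus l (fun i => ω (Fin.castLE t.2.le i)) τ) -
          bonus l (fun i => ω (Fin.castLE t.2.le i)) (ω t))}
  have hF : ∑ i ∈ (Finset.univ : Finset Bool), eventProb ρ P L (F i) ≤ δ := by
    have h1 := eventProb_exists_notMem_confSet_le (ρ := ρ) (P := P) (L := L) (T := T) hA hH hδ hδ1.le
    have h2 := eventProb_azuma_le (ρ := ρ) (P := P) (L := L) hT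
      (fun t ω τ => bonus l ω τ) (b := 2 * H) (by positivity)
      (fun t ω τ => bonus_mem_Icc l ω τ) (half_pos hδ) (by linarith)
    rw [Fintype.sum_bool]
    exact (add_le_add h1 h2).trans_eq (add_halves δ)
  refine (eventProb_le_sum Finset.univ F fun ω hω => ?_).trans hF
  by_contra! hcon
  have h1 : ω ∉ F true := hcon true (Finset.mem_univ _)
  have h2 : ω ∉ F false := hcon false (Finset.mem_univ _)
  simp only [F, if_true, Set.mem_ofPred_eq, not_exists, not_and, not_not] at h1
  simp only [F, Bool.false_eq_true, if_false, Set.mem_ofPred_eq, not_lt,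
    Finset.sum_sub_distrib] at h2
  refine hω (Set.mem_ofPred_eq ▸ regret_bound_arith (h := H) (s := S) (x := √(A * T))
    (by exact_mod_cast hH) (by exact_mod_cast hS) ?_ hl0 (sum_bonus_le hl0 hH ω)
    (m := √(T * Real.log (1 / (δ / 2)) / 2)) ?_ (sub_le_iff_le_add'.1 h2)
    (regret_le hn hH hA hr hδ hL h1))
  · exact Real.one_le_sqrt.2 (by nlinarith)
  · rw [← Real.sqrt_mul (by positivity)]
    refine Real.sqrt_le_sqrt ?_
    have h3 := log_two_div_le hS hA hT hδ
    have h4 : (T : ℝ) * Real.log (1 / (δ / 2)) ≤ T * (1 + l) := by gcongr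
    have h5 : T * (1 + l) ≤ A * T * (1 + l) := by
      gcongr
      exact le_mul_of_one_le_left (by linarith) hA'
    have h6 : 0 ≤ T * (1 + l) := by positivity
    linarith

end Regret

end FairRL

end

theorem mainTheorem4 :
    ∃ (C : ℝ) (k : ℕ), 0 < C ∧
      ∀ (S A n H T : ℕ), 0 < n → 0 < H →
      ∀ (ρ : stdSimplex ℝ (Fin S)) (P : FairRL.TransFn S A) (r : FairRL.Rewards S A n),
        (∀ i s a, 0 ≤ r i s a ∧ r i s a ≤ 1) →
      ∀ δ : ℝ, 0 < δ → δ < 1 →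
      ∀ L : FairRL.Learner S A H, FairRL.IsUCRL ρ r δ L →
        1 - δ ≤ FairRL.eventProb ρ P L
          {ω : Fin T → FairRL.Traj S A H |
            FairRL.regret ρ r P L ω ≤
              C * H ^ 2 * S * √(A * T) * (1 + Real.log (S * A * T / δ)) ^ k} := by
  refine ⟨16, 1, by norm_num, fun S A n H T hn hH ρ P r hr δ hδ hδ1 L hL => ?_⟩
  rcases Nat.eq_zero_or_pos T with rfl | hT
  · rw [FairRL.eventProb_compl]
    refine sub_le_sub_left (le_of_eq_of_le ?_ hδ.le) 1
    refine Finset.sum_eq_zero fun ω _ => Set.indicator_of_notMem (not_not.2 ?_) _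
    simp [FairRL.regret]
  · simp only [pow_one]
    exact FairRL.eventProb_regret_le_of_pos hn hH hT hr hδ hδ1 hL
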